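/- Let $\mathsf T$ be a Krull–Schmidt triangulated category with suspension $\Sigma$. All subcategories are full and closed under isomorphisms, direct sums are finite, and $\operatorname{add}\mathsf X$ denotes the direct summands of finite direct sums of objects of $\mathsf X$. **Definitions.** A *co-t-structure* is a pair $(\mathsf A,\mathsf B)$ of subcategories closed under direct sums and direct summands with $\Sigma^{-1}\mathsf A\subseteq\mathsf A$, $\Sigma\mathsf B\subseteq\mathsf B$, $\operatorname{Hom}(\mathsf A,\mathsf B)=0$, and such that each $t\in\mathsf T$ lies in a distinguished triangle $a\to t\to b\to\Sigma a$ with $a\in\mathsf A$, $b\in\mathsf B$. Its co-heart is $\mathsf C=\mathsf A\cap\Sigma^{-1}\mathsf B$; it is *bounded above* if $\mathsf T=\bigcup_{i\in\mathbb Z}\Sigma^i\mathsf B$. A subcategory $\mathsf S$ is *partial silting* if $\operatorname{Hom}(x,\Sigma^i y)=0$ for all $x,y\in\mathsf S$ and $i>0$; it is *silting* if moreover the smallest thick subcategory containing it is $\mathsf T$; a partial silting $\mathsf S$ is *almost silting* if there is an indecomposable object $s$ (a *complement*) with $\operatorname{add}(\mathsf S\cup\{s\})$ silting. A *co-slicing*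 of $\mathsf T$ is a linearly ordered set $\Phi$ with a subcategory $\mathsf Q(\phi)$, containing $0$ and closed under direct summands and extensions, for each $\phi\in\Phi$, such that: (1) there is an automorphism $\lambda$ of the ordered set $\Phi$ with $\lambda(\phi)\ge\phi$ and $\Sigma\mathsf Q(\phi)=\mathsf Q(\lambda(\phi))$ for all $\phi$; (2) $\operatorname{Hom}(\mathsf Q(\phi_1),\mathsf Q(\phi_2))=0$ whenever $\phi_1<\phi_2$; (3) each $t\neq0$ has a tower $0\cong t_0\to t_1\to\cdots\to t_n\cong t$ in which the cone $q_i$ of $t_{i-1}\to t_i$ satisfies $0\ne q_i\in\mathsf Q(\phi_i)$, with $\phi_1<\cdots<\phi_n$. For $\phi_0\in\Phi$, the pair *induced at* $\phi_0$ is $\big((\bigcup_{\phi<\phi_0}\mathsf Q(\phi))^+,\ (\bigcup_{\phi\ge\phi_0}\mathsf Q(\phi))^+\big)$, where $(-)^+$ is closure under extensions and direct summands (the zero object being always included). **Statement.** Let $(\mathsf A,\mathsf B)$ be a co-t-structure in $\mathsf T$ whose co-heart $\mathsf C$ is almost silting, and let $s$ be a complement for $\mathsf C$. Suppose that $\operatorname{Hom}(c,\Sigma^n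 s)=0$ for all $c\in\mathsf C$ and all $n\le 0$, and that $(\mathsf A,\mathsf B)$ is bounded above. Then: 1. The set $\Phi=\mathbb Z\cup\{\infty\}$, with the standard order on $\mathbb Z$ and $n<\infty$ for all $n\in\mathbb Z$, together with $\mathsf Q(n)=\Sigma^n\mathsf C$ for $n\in\mathbb Z$ and $\mathsf Q(\infty)=\bigcap_{i\in\mathbb Z}\Sigma^i\mathsf B$, is a co-slicing of $\mathsf T$, with automorphism $\lambda(n)=n+1$, $\lambda(\infty)=\infty$. 2. For each $n\in\mathbb Z\subset\Phi$, the pair induced at $n$ by this co-slicing is a co-t-structure, and it equals $(\Sigma^{n-1}\mathsf A,\Sigma^{n-1}\mathsf B)$. -/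

import Mathlib

universe u v

open CategoryTheory CategoryTheory.Limits CategoryTheory.Pretriangulated

namespace CoSlicing

section Suspension

variable {T : Type u} [Category.{v} T] [HasShift T ℤ]

/-- The subcategory `Σⁿ P`: the objects `X` such that `Σ⁻ⁿ X` lies in `P`.  For `P` closed under
isomorphisms these are the objects isomorphic to some `Σⁿ Y` with `Y` in `P`, see
`susp_iff_exists`. -/
def susp (n : ℤ) (P : ObjectProperty T) : ObjectProperty T := P.shift (-n)

theorem susp_iff_exists (n : ℤ) (P : ObjectProperty T) [P.IsClosedUnderIsomorphisms] (X : T) :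
    susp n P X ↔ ∃ Y : T, P Y ∧ Nonempty (X ≅ Y⟦n⟧) := by
  constructor
  · intro h
    exact ⟨X⟦-n⟧, h, ⟨(shiftEquiv' T (-n) n (by simp)).unitIso.app X⟩⟩
  · rintro ⟨Y, hY, ⟨e⟩⟩
    exact P.prop_of_iso ((shiftEquiv' T n (-n) (by simp)).unitIso.app Y ≪≫
      (shiftFunctor T (-n)).mapIso e.symm) hY

end Suspension

section Additive

variable {T : Type u} [Category.{v} T] [Preadditive T] [HasFiniteBiproducts T]

/-- `Hom(P, Q) = 0`. -/
def HomVanish (P Q : ObjectProperty T) : Prop :=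
  ∀ ⦃X Y : T⦄, P X → Q Y → ∀ f : X ⟶ Y, f = 0

variable (T) in
/-- Krull-Schmidt category: each object is a finite direct sum of objects with local
endomorphism rings. -/
def IsKrullSchmidt : Prop :=
  ∀ X : T, ∃ (n : ℕ) (f : Fin n → T),
    (∀ i, IsLocalRing (End (f i))) ∧ Nonempty (X ≅ ⨁ f)

/-- `add P`: the direct summands of finite direct sums of objects of `P`.  (In a triangulated
category the retracts of an object are exactly its direct summands.) -/
def addClosure (P : ObjectProperty T) : ObjectProperty T := fun X =>
  ∃ (n : ℕ) (f : Fin n → T), (∀ i, P (f i)) ∧ Nonempty (Retract X (⨁ f))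

end Additive

variable {T : Type u} [Category.{v} T] [HasZeroObject T] [HasShift T ℤ] [Preadditive T]
  [∀ n : ℤ, (shiftFunctor T n).Additive] [Pretriangulated T]

/-- Co-t-structures (weight structures). -/
structure IsCoTStructure (A B : ObjectProperty T) : Prop where
  sum_left : ∀ ⦃X Y : T⦄, A X → A Y → A (X ⊞ Y)
  sum_right : ∀ ⦃X Y : T⦄, B X → B Y → B (X ⊞ Y)
  summand_left : A.IsStableUnderRetracts
  summand_right : B.IsStableUnderRetracts
  susp_left : susp (-1) A ≤ A
  susp_right : susp 1 B ≤ B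
  hom_vanish : HomVanish A B
  exists_triangle : ∀ t : T, ∃ (a b : T) (f : a ⟶ t) (g : t ⟶ b) (h : b ⟶ a⟦(1 : ℤ)⟧),
    A a ∧ B b ∧ Triangle.mk f g h ∈ distTriang T

/-- The co-heart `A ∩ Σ⁻¹ B`. -/
def coheart (A B : ObjectProperty T) : ObjectProperty T := A ⊓ susp (-1) B

/-- `(A, B)` is bounded above if `T = ⋃ᵢ Σⁱ B`. -/
def IsBoundedAbove (B : ObjectProperty T) : Prop := ∀ t : T, ∃ i : ℤ, susp i B t

/-- Partial silting subcategories: `Hom(x, Σⁱ y) = 0` for all `x`, `y` in `S` and `i > 0`. -/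
def IsPartialSilting (S : ObjectProperty T) : Prop :=
  ∀ ⦃x y : T⦄, S x → S y → ∀ i : ℤ, 0 < i → ∀ f : x ⟶ y⟦i⟧, f = 0

/-- Silting subcategories: partial silting, and the smallest thick subcategory containing `S`
(`ObjectProperty.triangEnvelope`) is everything. -/
def IsSilting (S : ObjectProperty T) : Prop :=
  IsPartialSilting S ∧ S.triangEnvelope = ⊤

/-- `s` is a complement of `S`: it is indecomposable and `add (S ∪ {s})` is silting. -/
def IsComplement (S : ObjectProperty T) (s : T) : Prop :=
  Indecomposable s ∧ IsSilting (addClosure (S ⊔ ObjectProperty.singleton s))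

/-- Almost silting subcategories. -/
def IsAlmostSilting (S : ObjectProperty T) : Prop :=
  IsPartialSilting S ∧ ∃ s : T, IsComplement S s

section Slices

variable {Φ : Type*} [LinearOrder Φ]

/-- `t` sits in a tower `0 ≅ t₀ ⟶ t₁ ⟶ ⋯ ⟶ tₙ ≅ t` such that the cone of `tᵢ ⟶ tᵢ₊₁` is a
non-zero object of `Q (φᵢ)`, with strictly increasing phases `φᵢ`. -/
def HasHNFiltration (Q : Φ → ObjectProperty T) (t : T) : Prop :=
  ∃ (n : ℕ) (x : Fin (n + 1) → T) (q : Fin n → T) (φ : Fin n → Φ),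
    IsZero (x 0) ∧ Nonempty (x (Fin.last n) ≅ t) ∧ StrictMono φ ∧
    ∀ i : Fin n, ¬ IsZero (q i) ∧ Q (φ i) (q i) ∧
      ∃ (f : x i.castSucc ⟶ x i.succ) (g : x i.succ ⟶ q i)
        (h : q i ⟶ (x i.castSucc)⟦(1 : ℤ)⟧), Triangle.mk f g h ∈ distTriang T

/-- `(Φ, Q)` is a (generalised) co-slicing, with `lam` as the automorphism of the ordered set `Φ`
through which the suspension acts on phases. -/
structure IsCoSlicingWith (lam : Φ ≃o Φ) (Q : Φ → ObjectProperty T) : Prop where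
  zero_mem : ∀ φ, (Q φ).ContainsZero
  summand : ∀ φ, (Q φ).IsStableUnderRetracts
  extension : ∀ φ, (Q φ).IsTriangulatedClosed₂
  le_lam : ∀ φ, φ ≤ lam φ
  susp_eq : ∀ φ, susp 1 (Q φ) = Q (lam φ)
  hom_vanish : ∀ ⦃φ₁ φ₂ : Φ⦄, φ₁ < φ₂ → HomVanish (Q φ₁) (Q φ₂)
  hn : ∀ t : T, ¬ IsZero t → HasHNFiltration Q t

/-- `(Φ, Q)` is a (generalised) co-slicing. -/
def IsCoSlicing (Q : Φ → ObjectProperty T) : Prop := ∃ lam : Φ ≃o Φ, IsCoSlicingWith lam Q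

/-- `P⁺`: the closure of `P` under extensions and direct summands (the zero object, the empty
extension, is always included). -/
inductive plusClosure (P : ObjectProperty T) : ObjectProperty T
  | of {X : T} (h : P X) : plusClosure P X
  | zero {X : T} (h : IsZero X) : plusClosure P X
  | ext (D : Triangle T) (hD : D ∈ distTriang T) (h₁ : plusClosure P D.obj₁)
      (h₃ : plusClosure P D.obj₃) : plusClosure P D.obj₂
  | summand {X Y : T} (r : Retract X Y) (h : plusClosure P Y) : plusClosure P X

/-- The left half `(⋃_{φ < φ₀} Q φ)⁺` of the co-t-structure induced at `φ₀`. -/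
def inducedLeft (Q : Φ → ObjectProperty T) (φ₀ : Φ) : ObjectProperty T :=
  plusClosure (fun X => ∃ φ, φ < φ₀ ∧ Q φ X)

/-- The right half `(⋃_{φ ≥ φ₀} Q φ)⁺` of the co-t-structure induced at `φ₀`. -/
def inducedRight (Q : Φ → ObjectProperty T) (φ₀ : Φ) : ObjectProperty T :=
  plusClosure (fun X => ∃ φ, φ₀ ≤ φ ∧ Q φ X)

end Slices

/-- The automorphism `n ↦ n + 1`, `∞ ↦ ∞` of the ordered set `ℤ ∪ {∞}`. -/
noncomputable def lamInfty : WithTop ℤ ≃o WithTop ℤ := (OrderIso.addRight (1 : ℤ)).withTopCongr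

theorem lamInfty_coe (n : ℤ) : lamInfty (n : WithTop ℤ) = ((n + 1 : ℤ) : WithTop ℤ) := rfl

theorem lamInfty_top : lamInfty ⊤ = ⊤ := rfl

/-- `Q(n) = Σⁿ C`, where `C` is the co-heart of `(A, B)`, and `Q(∞) = ⋂ᵢ Σⁱ B`. -/
def coSlice (A B : ObjectProperty T) : WithTop ℤ → ObjectProperty T
  | (n : ℤ) => susp n (coheart A B)
  | ⊤ => ⨅ i : ℤ, susp i B

end CoSlicing

/-! Put U = ⋃ Σⁿ A and D = ⋂ Σⁿ B. Then U is thick and D is its right orthogonal. The hypotheses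
give Hom(c, Σⁿ s) = 0 for every n and every c in the co-heart, and raising the bound s ∈ Σⁱ B one
suspension at a time puts s in D (`mem_iInf_right_of_hom_coheart_eq_zero`).

Let U * D be the class of objects t with a triangle a → t → d, a ∈ U, d ∈ D. It is triangulated
because Hom(U, D) = 0, and closed under retracts because Krull–Schmidt categories have split
idempotents. It contains the co-heart and s, so it is all of T (`exists_triangle_iSup_iInf`).

If t ∈ Σⁱ B, then a ∈ Σⁱ B ∩ Σⁿ A for some n, and truncating a repeatedly gives a finite tower with
factors in suspensions of the co-heart (`IsCoTStructure.hasHNFiltration`). Appending d in phase ∞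
yields the tower of t, and cutting towers at n identifies the induced pair. -/

namespace CoSlicing

/-! ### Splitting of idempotents -/

section Idempotents

variable {T : Type u} [Category.{v} T]

/-- The endomorphism `e` factors as a retraction followed by its section. -/
def Splits {X : T} (e : X ⟶ X) : Prop :=
  ∃ (Y : T) (i : Y ⟶ X) (p : X ⟶ Y), i ≫ p = 𝟙 Y ∧ p ≫ i = e

variable [Preadditive T]

theorem Splits.add [HasBinaryBiproducts T] {X : T} {f g : X ⟶ X} (hf : Splits f) (hg : Splits g)
    (hfg : f ≫ g = 0) (hgf : g ≫ f = 0) : Splits (f + g) := by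
  obtain ⟨Y, i, p, hip, rfl⟩ := hf
  obtain ⟨Z, j, q, hjq, rfl⟩ := hg
  have h₁ : i ≫ q = 0 := by
    have := i ≫= (hfg =≫ q)
    simpa [reassoc_of% hip, hjq] using this
  have h₂ : j ≫ p = 0 := by
    have := j ≫= (hgf =≫ p)
    simpa [reassoc_of% hjq, hip] using this
  refine ⟨Y ⊞ Z, biprod.desc i j, biprod.lift p q, ?_, by simp [biprod.lift_desc]⟩
  apply biprod.hom_ext <;> apply biprod.hom_ext' <;> simp [hip, hjq, h₁, h₂]

/-- An idempotent of a direct sum `Y ⊕ Z` whose component on `Y` is invertible splits as soon as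
the idempotents of `Z` do. -/
theorem splits_of_isIso_component [HasBinaryBiproducts T] {X Y Z : T} {iY : Y ⟶ X} {pY : X ⟶ Y}
    {iZ : Z ⟶ X} {pZ : X ⟶ Z} (total : pY ≫ iY + pZ ≫ iZ = 𝟙 X)
    (hZ : ∀ e : Z ⟶ Z, e ≫ e = e → Splits e) (e : X ⟶ X) (he : e ≫ e = e)
    [IsIso (iY ≫ e ≫ pY)] : Splits e := by
  obtain ⟨w, hw₁, hw₂⟩ : ∃ w : Y ⟶ Y, iY ≫ e ≫ pY ≫ w = 𝟙 Y ∧ w ≫ iY ≫ e ≫ pY = 𝟙 Y :=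
    ⟨inv (iY ≫ e ≫ pY), by simp only [← Category.assoc, IsIso.hom_inv_id], by simp⟩
  have he' : ∀ {W : T} (h : X ⟶ W), e ≫ e ≫ h = e ≫ h := fun h ↦ by
    rw [← Category.assoc, he]
  have hw₁' : ∀ {W : T} (h : Y ⟶ W), iY ≫ e ≫ pY ≫ w ≫ h = h := fun h ↦ by
    simpa using hw₁ =≫ h
  have hw₂' : ∀ {W : T} (h : Y ⟶ W), w ≫ iY ≫ e ≫ pY ≫ h = h := fun h ↦ by
    simpa using hw₂ =≫ h
  -- The part of `e` seen by `Y`: an idempotent below `e`, split through `Y`. The remainder `e - f`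
  -- vanishes on `Y` from both sides, so it is an idempotent of `Z`.
  set f : X ⟶ X := e ≫ pY ≫ w ≫ iY ≫ e with hf
  have hfS : Splits f := ⟨Y, w ≫ iY ≫ e, e ≫ pY, by simp [he', hw₂], by simp [hf]⟩
  have hff : f ≫ f = f := by simp [hf, he', hw₂']
  have hef : e ≫ f = f := by simp [hf, he']
  have hfe : f ≫ e = f := by simp [hf, he]
  set g := e - f with hg
  have hgg : g ≫ g = g := by simp [hg, he, hff, hef, hfe]
  have hYg : iY ≫ g = 0 := by simp [hg, hf, hw₁']
  have hgY : g ≫ pY = 0 := by simp [hg, hf, hw₂]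
  have hg₁ : pZ ≫ iZ ≫ g = g := by
    have := total =≫ g
    simpa [hYg] using this
  have hg₂ : g ≫ pZ ≫ iZ = g := by
    have := g ≫= total
    simpa [reassoc_of% hgY] using this
  obtain ⟨W, i, p, hip, hpi⟩ := hZ (iZ ≫ g ≫ pZ) (by
    simp only [Category.assoc]
    rw [reassoc_of% hg₁, reassoc_of% hgg])
  have hgS : Splits g := by
    refine ⟨W, i ≫ iZ ≫ g, g ≫ pZ ≫ p, ?_, ?_⟩
    · have h : i ≫ (iZ ≫ g ≫ pZ) ≫ p = 𝟙 W := by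
        rw [← hpi]; simp [hip]
      simpa [reassoc_of% hgg] using h
    · have h := g ≫= pZ ≫= (hpi =≫ (iZ ≫ g))
      simp only [Category.assoc] at h ⊢
      rw [h, reassoc_of% hg₂, hg₁, hgg, hgg]
  have := hfS.add hgS (by simp [hg, hfe, hff]) (by simp [hg, hef, hff])
  simpa [hg] using this

end Idempotents

variable {T : Type u} [Category.{v} T] [HasZeroObject T] [HasShift T ℤ] [Preadditive T]
  [∀ n : ℤ, (shiftFunctor T n).Additive] [Pretriangulated T]

section Exactness

variable {X Y Z W : T} {f : X ⟶ Y} {g : Y ⟶ Z} {h : Z ⟶ X⟦(1 : ℤ)⟧}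

theorem exists_desc_of_distTriang (H : Triangle.mk f g h ∈ distTriang T) (x : Y ⟶ W)
    (hx : f ≫ x = 0) : ∃ y : Z ⟶ W, x = g ≫ y :=
  Triangle.yoneda_exact₂ _ H x hx

theorem exists_lift_of_distTriang (H : Triangle.mk f g h ∈ distTriang T) (x : W ⟶ Y)
    (hx : x ≫ g = 0) : ∃ y : W ⟶ X, x = y ≫ f :=
  Triangle.coyoneda_exact₂ _ H x hx

theorem exists_lift_of_distTriang₃ (H : Triangle.mk f g h ∈ distTriang T) (x : W ⟶ Z)
    (hx : x ≫ h = 0) : ∃ y : W ⟶ Y, x = y ≫ g :=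
  Triangle.coyoneda_exact₃ _ H x hx

theorem exists_lift_of_distTriang₁ (H : Triangle.mk f g h ∈ distTriang T)
    (x : W ⟶ X⟦(1 : ℤ)⟧) (hx : x ≫ f⟦(1 : ℤ)⟧' = 0) : ∃ y : W ⟶ Z, x = y ≫ h :=
  Triangle.coyoneda_exact₁ _ H x hx

theorem exists_lift_of_distTriang₀ (H : Triangle.mk f g h ∈ distTriang T) (x : W ⟶ X)
    (hx : x ≫ f = 0) : ∃ (y : W ⟶ Z⟦(-1 : ℤ)⟧) (k : Z⟦(-1 : ℤ)⟧ ⟶ X), x = y ≫ k := by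
  obtain ⟨y, hy⟩ := Triangle.coyoneda_exact₂ _ (inv_rot_of_distTriang _ H) x hx
  exact ⟨y, _, hy⟩

end Exactness

/-- The cone of the split mono onto the image of `𝟙 X - e` is a complement of that image, and it
serves as the image of `e`. -/
theorem Splits.of_id_sub {X : T} {e : X ⟶ X} (h : Splits (𝟙 X - e)) : Splits e := by
  obtain ⟨Y, i, p, hip, hpi⟩ := h
  obtain ⟨Z, q, w, hT⟩ := distinguished_cocone_triangle i
  have hie : i ≫ e = 0 := by
    have := i ≫= hpi
    rw [reassoc_of% hip, Preadditive.comp_sub, Category.comp_id] at this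
    simpa using this.symm
  obtain ⟨r, hr⟩ := exists_desc_of_distTriang hT e hie
  have hiq : i ≫ q = 0 := comp_distTriang_mor_zero₁₂ _ hT
  have hw : w = 0 := (Triangle.mor₃_eq_zero_iff_mono₁ _ hT).2
    (show Mono i from (SplitMono.mk p hip).mono)
  have : Epi q := (Triangle.mor₃_eq_zero_iff_epi₂ _ hT).1 hw
  refine ⟨Z, r, q, ?_, hr.symm⟩
  rw [← cancel_epi q, ← Category.assoc, ← hr, Category.comp_id]
  have := hpi =≫ q
  simp only [Category.assoc, hiq, comp_zero, Preadditive.sub_comp, Category.id_comp] at this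
  exact (sub_eq_zero.1 this.symm).symm

/-- The `Y`-components of `e` and `𝟙 X - e` add up to 1, so locality makes one of them invertible.
-/
theorem splits_of_isLocalRing {X Y Z : T} [IsLocalRing (End Y)] {iY : Y ⟶ X} {pY : X ⟶ Y}
    {iZ : Z ⟶ X} {pZ : X ⟶ Z} (hY : iY ≫ pY = 𝟙 Y) (total : pY ≫ iY + pZ ≫ iZ = 𝟙 X)
    (hZ : ∀ e : Z ⟶ Z, e ≫ e = e → Splits e) (e : X ⟶ X) (he : e ≫ e = e) : Splits e := by
  let a : End Y := iY ≫ e ≫ pY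
  let b : End Y := iY ≫ (𝟙 X - e) ≫ pY
  have hab : a + b = 1 := by
    simp [a, b, hY, End.one_def]
  rcases IsLocalRing.isUnit_or_isUnit_of_add_one hab with h | h
  · have : IsIso (iY ≫ e ≫ pY) := (isUnit_iff_isIso _).1 h
    exact splits_of_isIso_component total hZ e he
  · have : IsIso (iY ≫ (𝟙 X - e) ≫ pY) := (isUnit_iff_isIso _).1 h
    exact (splits_of_isIso_component total hZ _
      (Idempotents.idem_of_id_sub_idem e he)).of_id_sub

theorem splits_of_biproduct {n : ℕ} (f : Fin n → T) (hf : ∀ i, IsLocalRing (End (f i)))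
    (e : ⨁ f ⟶ ⨁ f) (he : e ≫ e = e) : Splits e := by
  induction n with
  | zero =>
    refine ⟨⨁ f, 𝟙 _, 𝟙 _, by simp, ?_⟩
    apply biproduct.hom_ext
    exact fun i ↦ i.elim0
  | succ n ih =>
    have := hf 0
    refine splits_of_isLocalRing (Y := f 0) (Z := ⨁ fun i : Fin n ↦ f i.succ)
      (iY := biproduct.ι f 0) (pY := biproduct.π f 0)
      (iZ := biproduct.desc fun i ↦ biproduct.ι f i.succ)
      (pZ := biproduct.lift fun i ↦ biproduct.π f i.succ) (by simp) ?_
      (ih _ fun i ↦ hf i.succ) e he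
    rw [biproduct.lift_desc, ← biproduct.total, Fin.sum_univ_succ]

theorem IsKrullSchmidt.isIdempotentComplete (hT : IsKrullSchmidt T) : IsIdempotentComplete T where
  idempotents_split X p hp := by
    obtain ⟨n, f, hf, ⟨φ⟩⟩ := hT X
    exact (Idempotents.split_iff_of_iso φ p (φ.inv ≫ p ≫ φ.hom) (by simp)).2
      (splits_of_biproduct f hf _ (by simp [reassoc_of% hp]))

/-- Coreflections onto a subcategory descend along retracts. -/
theorem isStableUnderRetracts_extensionProduct_rightOrthogonal [IsIdempotentComplete T]
    (P : ObjectProperty T) [P.IsStableUnderRetracts] [P.IsStableUnderShift ℤ] :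
    (P.extensionProduct P.rightOrthogonal).IsStableUnderRetracts where
  of_retract := by
    rintro t t' ρ ⟨u, v, α, β, γ, hT, hu, hv⟩
    -- Lifts along `α` from objects of `P` are unique, so the idempotent `ρ.r ≫ ρ.i` induces an
    -- idempotent `e` of `u`. Its image `u₁` is the candidate coreflection of `t`.
    have inj : ∀ {a : T}, P a → ∀ x : a ⟶ u, x ≫ α = 0 → x = 0 := fun {a} ha x hx ↦ by
      obtain ⟨y, k, hy⟩ := exists_lift_of_distTriang₀ hT x hx
      rw [hy, P.rightOrthogonal.le_shift (-1 : ℤ) _ hv y ha, zero_comp]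
    obtain ⟨e, he⟩ := exists_lift_of_distTriang hT (α ≫ ρ.r ≫ ρ.i) (hv _ hu)
    have hee : e ≫ e = e := by
      rw [← sub_eq_zero]
      apply inj hu
      rw [Preadditive.sub_comp, Category.assoc, ← he, ← reassoc_of% he]
      simp
    obtain ⟨u₁, j, p, hjp, hpj⟩ := IsIdempotentComplete.idempotents_split u e hee
    have hje : j ≫ e = j := by rw [← hpj, reassoc_of% hjp]
    obtain ⟨c, β₁, γ₁, hT₁⟩ := distinguished_cocone_triangle (j ≫ α ≫ ρ.r)
    refine ⟨u₁, c, _, β₁, γ₁, hT₁, P.prop_of_retract ⟨j, p, hjp⟩ hu, fun a f ha ↦ ?_⟩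
    -- By this injectivity every map from `a` to the cone lifts to `t`. Maps from `a` to `t` factor
    -- through `u₁`, so they die in the cone.
    have inj₁ : ∀ x : a ⟶ u₁⟦(1 : ℤ)⟧, x ≫ (j ≫ α ≫ ρ.r)⟦(1 : ℤ)⟧' = 0 → x = 0 := by
      intro x hx
      have h₁ : (x ≫ j⟦(1 : ℤ)⟧') ≫ α⟦(1 : ℤ)⟧' = 0 := by
        have h : (j ≫ α ≫ ρ.r) ≫ ρ.i = j ≫ α := by
          simp only [Category.assoc, he, reassoc_of% hje]
        rw [Category.assoc, ← Functor.map_comp, ← h, Functor.map_comp, reassoc_of% hx, zero_comp]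
      obtain ⟨y, hy⟩ := exists_lift_of_distTriang₁ hT _ h₁
      rw [hv y ha, zero_comp] at hy
      have h₂ : (x ≫ j⟦(1 : ℤ)⟧') ≫ p⟦(1 : ℤ)⟧' = x := by
        rw [Category.assoc, ← Functor.map_comp, hjp, CategoryTheory.Functor.map_id,
          Category.comp_id]
      rw [← h₂, hy, zero_comp]
    have hfγ : f ≫ γ₁ = 0 := inj₁ _ (by
      have : γ₁ ≫ (j ≫ α ≫ ρ.r)⟦(1 : ℤ)⟧' = 0 := comp_distTriang_mor_zero₃₁ _ hT₁
      rw [Category.assoc, this, comp_zero])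
    obtain ⟨g, hg⟩ := exists_lift_of_distTriang₃ hT₁ f hfγ
    obtain ⟨k, hk⟩ := exists_lift_of_distTriang hT (g ≫ ρ.i) (hv _ ha)
    have hg' : g = (k ≫ p) ≫ j ≫ α ≫ ρ.r := by
      have h : g ≫ ρ.i ≫ ρ.r = k ≫ α ≫ ρ.r := by rw [reassoc_of% hk]
      rw [ρ.retract, Category.comp_id] at h
      have h' : α ≫ ρ.r = e ≫ α ≫ ρ.r := by
        have := he =≫ ρ.r
        simpa using this
      rw [h, h', ← hpj]
      simp [reassoc_of% hjp]
    have h0 : (j ≫ α ≫ ρ.r) ≫ β₁ = 0 := comp_distTriang_mor_zero₁₂ _ hT₁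
    rw [hg, hg', Category.assoc, h0, comp_zero]

/-- Write D for the right orthogonal. The connecting map of a triangle in D * P runs from P to ΣD,
so it vanishes and the triangle splits: D * P ⊆ P * D. Hence (P * D) * (P * D) ⊆ P * P * D * D ⊆ P *
D. -/
theorem isTriangulatedClosed₂_extensionProduct_rightOrthogonal [IsTriangulated T]
    (P : ObjectProperty T) [P.IsTriangulated] [P.IsClosedUnderIsomorphisms] :
    (P.extensionProduct P.rightOrthogonal).IsTriangulatedClosed₂ := by
  set D := P.rightOrthogonal
  have hswap : D.extensionProduct P ≤ P.extensionProduct D := by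
    rintro X ⟨d, a, f, g, h, hT, hd, ha⟩
    have hh : h = 0 := D.le_shift (1 : ℤ) _ hd h ha
    obtain ⟨e, he⟩ := exists_iso_binaryBiproduct_of_distTriang _ hT hh
    exact (P.extensionProduct D).prop_of_iso (biprod.braiding a d ≪≫ e.symm)
      ⟨_, _, _, _, _, binaryBiproductTriangle_distinguished a d, ha, hd⟩
  have hP : P.extensionProduct P ≤ P :=
    ObjectProperty.extensionProduct_le_of_isTriangulatedClosed₂ le_rfl le_rfl
  have hD : D.extensionProduct D ≤ D :=
    ObjectProperty.extensionProduct_le_of_isTriangulatedClosed₂ le_rfl le_rfl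
  have key : (P.extensionProduct D).extensionProduct (P.extensionProduct D) ≤
      P.extensionProduct D := by
    rw [ObjectProperty.extensionProduct_assoc, ← ObjectProperty.extensionProduct_assoc D P D]
    refine (ObjectProperty.monotone_extensionProduct_right _
      (ObjectProperty.monotone_extensionProduct_left _ hswap)).trans ?_
    rw [ObjectProperty.extensionProduct_assoc P D D, ← ObjectProperty.extensionProduct_assoc]
    exact (ObjectProperty.monotone_extensionProduct_left _ hP).trans
      (ObjectProperty.monotone_extensionProduct_right _ hD)
  exact .mk' fun X hX h₁ h₃ ↦ key _ ⟨_, _, _, _, _, hX, h₁, h₃⟩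

end CoSlicing

namespace CoSlicing

section Shift

variable {T : Type u} [Category.{v} T] [HasShift T ℤ]

theorem susp_susp (m n : ℤ) (P : ObjectProperty T) [P.IsClosedUnderIsomorphisms] :
    susp m (susp n P) = susp (m + n) P :=
  P.shift_shift (-m) (-n) (-(m + n)) (by ring)

theorem susp_zero (P : ObjectProperty T) [P.IsClosedUnderIsomorphisms] : susp 0 P = P := by
  simp [susp]

theorem susp_mono (n : ℤ) {P Q : ObjectProperty T} (h : P ≤ Q) : susp n P ≤ susp n Q :=
  fun _ hX ↦ h _ hX

theorem susp_shift_iff (n m : ℤ) (P : ObjectProperty T) [P.IsClosedUnderIsomorphisms] (X : T) :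
    susp n P (X⟦m⟧) ↔ susp (n - m) P X :=
  P.prop_iff_of_iso ((shiftFunctorAdd' T m (-n) (-(n - m)) (by ring)).symm.app X)

instance (n : ℤ) (P : ObjectProperty T) [P.IsStableUnderRetracts] :
    (susp n P).IsStableUnderRetracts where
  of_retract r h := P.prop_of_retract (r.map (shiftFunctor T (-n))) h

instance (n : ℤ) (P : ObjectProperty T) [P.IsClosedUnderIsomorphisms] :
    (susp n P).IsClosedUnderIsomorphisms :=
  inferInstanceAs (P.shift (-n)).IsClosedUnderIsomorphisms

end Shift

variable {T : Type u} [Category.{v} T] [HasZeroObject T] [HasShift T ℤ] [Preadditive T]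
  [∀ n : ℤ, (shiftFunctor T n).Additive] [Pretriangulated T]

instance rightOrthogonal_isStableUnderRetracts (P : ObjectProperty T) :
    P.rightOrthogonal.IsStableUnderRetracts where
  of_retract r h X f hX := by
    have := h (f ≫ r.i) hX =≫ r.r
    simpa using this

/-! ### Orthogonality and closure properties of co-t-structures -/

namespace IsCoTStructure

variable {A B : ObjectProperty T}

theorem isClosedUnderIsomorphisms_left (hAB : IsCoTStructure A B) : A.IsClosedUnderIsomorphisms :=
  have := hAB.summand_left; inferInstance

theorem isClosedUnderIsomorphisms_right (hAB : IsCoTStructure A B) : B.IsClosedUnderIsomorphisms :=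
  have := hAB.summand_right; inferInstance

/-- If `a ⟶ X` vanishes, `X ⟶ b` is a split mono. Extension closure of `B` then comes for free. -/
theorem rightOrthogonal_eq (hAB : IsCoTStructure A B) : A.rightOrthogonal = B := by
  have := hAB.summand_right
  refine le_antisymm (fun X hX ↦ ?_) fun X hX Y f hY ↦ hAB.hom_vanish hY hX f
  obtain ⟨a, b, f, g, h, ha, hb, H⟩ := hAB.exists_triangle X
  obtain ⟨y, hy⟩ := exists_desc_of_distTriang H (𝟙 X) (by rw [hX f ha, zero_comp])
  exact B.prop_of_retract ⟨g, y, hy.symm⟩ hb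

theorem leftOrthogonal_eq (hAB : IsCoTStructure A B) : B.leftOrthogonal = A := by
  have := hAB.summand_left
  refine le_antisymm (fun X hX ↦ ?_) fun X hX Y f hY ↦ hAB.hom_vanish hX hY f
  obtain ⟨a, b, f, g, h, ha, hb, H⟩ := hAB.exists_triangle X
  obtain ⟨y, hy⟩ := exists_lift_of_distTriang H (𝟙 X) (by rw [hX g hb, comp_zero])
  exact A.prop_of_retract ⟨y, f, hy.symm⟩ ha

theorem susp_left_mono (hAB : IsCoTStructure A B) {m n : ℤ} (h : m ≤ n) : susp m A ≤ susp n A := by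
  have := hAB.isClosedUnderIsomorphisms_left
  induction n, h using Int.leInduction with
  | base => exact le_rfl
  | succ n _ ih =>
    refine ih.trans ?_
    have := susp_mono (n + 1) hAB.susp_left
    rwa [susp_susp, show n + 1 + -1 = n by ring] at this

theorem susp_right_anti (hAB : IsCoTStructure A B) {m n : ℤ} (h : m ≤ n) :
    susp n B ≤ susp m B := by
  have := hAB.isClosedUnderIsomorphisms_right
  induction n, h using Int.leInduction with
  | base => exact le_rfl
  | succ n _ ih =>
    refine le_trans ?_ ih
    have := susp_mono n hAB.susp_right
    rwa [susp_susp] at this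

/-- The suspensions of a co-t-structure are co-t-structures. -/
theorem shift (hAB : IsCoTStructure A B) (n : ℤ) : IsCoTStructure (susp n A) (susp n B) := by
  have := hAB.summand_left
  have := hAB.summand_right
  refine ⟨fun X Y hX hY ↦ ?_, fun X Y hX hY ↦ ?_, inferInstance, inferInstance, ?_, ?_,
    fun X Y hX hY f ↦ ?_, fun t ↦ ?_⟩
  · have := preservesBinaryBiproducts_of_preservesBiproducts (shiftFunctor T (-n))
    exact A.prop_of_iso ((shiftFunctor T (-n)).mapBiprod X Y).symm (hAB.sum_left hX hY)
  · have := preservesBinaryBiproducts_of_preservesBiproducts (shiftFunctor T (-n))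
    exact B.prop_of_iso ((shiftFunctor T (-n)).mapBiprod X Y).symm (hAB.sum_right hX hY)
  · rw [susp_susp]
    exact hAB.susp_left_mono (by lia)
  · rw [susp_susp]
    exact hAB.susp_right_anti (by lia)
  · exact (shiftFunctor T (-n)).map_injective (by
      rw [hAB.hom_vanish hX hY ((shiftFunctor T (-n)).map f), Functor.map_zero])
  · obtain ⟨a, b, f, g, h, ha, hb, H⟩ := hAB.exists_triangle (t⟦-n⟧)
    have ht : (susp n A).extensionProduct (susp n B) ((t⟦-n⟧)⟦n⟧) :=
      ⟨_, _, _, _, _, Triangle.shift_distinguished _ H n,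
        (susp_iff_exists n A _).2 ⟨a, ha, ⟨Iso.refl _⟩⟩,
        (susp_iff_exists n B _).2 ⟨b, hb, ⟨Iso.refl _⟩⟩⟩
    obtain ⟨a, b, f, g, h, H, ha, hb⟩ := ObjectProperty.prop_of_iso _
      ((shiftEquiv' T (-n) n (by simp)).unitIso.app t).symm ht
    exact ⟨a, b, f, g, h, ha, hb, H⟩

theorem extension_left (hAB : IsCoTStructure A B) (n : ℤ) :
    (susp n A).IsTriangulatedClosed₂ := by
  rw [← (hAB.shift n).leftOrthogonal_eq]; infer_instance

theorem extension_right (hAB : IsCoTStructure A B) (n : ℤ) :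
    (susp n B).IsTriangulatedClosed₂ := by
  rw [← (hAB.shift n).rightOrthogonal_eq]; infer_instance

variable {X Y Z : T} {f : X ⟶ Y} {g : Y ⟶ Z} {h : Z ⟶ X⟦(1 : ℤ)⟧}

theorem left_of_distTriang₂ (hAB : IsCoTStructure A B) (H : Triangle.mk f g h ∈ distTriang T)
    {n : ℤ} (hX : susp n A X) (hZ : susp n A Z) : susp n A Y := by
  have := hAB.isClosedUnderIsomorphisms_left
  have := hAB.extension_left n
  exact (susp n A).ext_of_isTriangulatedClosed₂ _ H hX hZ

theorem right_of_distTriang₂ (hAB : IsCoTStructure A B) (H : Triangle.mk f g h ∈ distTriang T)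
    {n : ℤ} (hX : susp n B X) (hZ : susp n B Z) : susp n B Y := by
  have := hAB.isClosedUnderIsomorphisms_right
  have := hAB.extension_right n
  exact (susp n B).ext_of_isTriangulatedClosed₂ _ H hX hZ

theorem left_of_distTriang₃ (hAB : IsCoTStructure A B) (H : Triangle.mk f g h ∈ distTriang T)
    {m n : ℤ} (hmn : m + 1 ≤ n) (hX : susp m A X) (hY : susp n A Y) : susp n A Z := by
  have := hAB.isClosedUnderIsomorphisms_left
  have := hAB.extension_left n
  refine (susp n A).ext_of_isTriangulatedClosed₂ _ (rot_of_distTriang _ H) hY ?_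
  exact (susp_shift_iff n 1 A X).2 (hAB.susp_left_mono (by lia) _ hX)

/-- `X` is an extension of `Y` by Σ⁻¹ `Z`; the desuspension costs one step, hence `m + 1 ≤ n`. -/
theorem right_of_distTriang₁ (hAB : IsCoTStructure A B) (H : Triangle.mk f g h ∈ distTriang T)
    {m n : ℤ} (hmn : m + 1 ≤ n) (hY : susp m B Y) (hZ : susp n B Z) : susp m B X := by
  have := hAB.isClosedUnderIsomorphisms_right
  have := hAB.extension_right m
  refine (susp m B).ext_of_isTriangulatedClosed₂ _ (inv_rot_of_distTriang _ H) ?_ hY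
  exact (susp_shift_iff m (-1) B Z).2 (hAB.susp_right_anti (by lia) _ hZ)

theorem susp_coheart (hAB : IsCoTStructure A B) (n : ℤ) :
    susp n (coheart A B) = susp n A ⊓ susp (n - 1) B := by
  have := hAB.isClosedUnderIsomorphisms_right
  rw [sub_eq_add_neg, ← susp_susp]
  rfl

theorem zero_left (hAB : IsCoTStructure A B) (n : ℤ) {X : T} (hX : IsZero X) : susp n A X := by
  rw [← (hAB.shift n).leftOrthogonal_eq]
  exact fun Y f _ ↦ hX.eq_of_src _ _

theorem zero_right (hAB : IsCoTStructure A B) (n : ℤ) {X : T} (hX : IsZero X) : susp n B X := by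
  rw [← (hAB.shift n).rightOrthogonal_eq]
  exact fun Y f _ ↦ hX.eq_of_tgt _ _

theorem isZero_of_left_right (hAB : IsCoTStructure A B) {n : ℤ} {X : T} (hA : susp n A X)
    (hB : susp n B X) : IsZero X :=
  (IsZero.iff_id_eq_zero X).2 ((hAB.shift n).hom_vanish hA hB _)

end IsCoTStructure

/-! ### Towers and extension closures -/

section Filtrations

variable {Φ : Type*} [LinearOrder Φ]

theorem HasHNFiltration.mono {Q Q' : Φ → ObjectProperty T} (h : ∀ φ, Q φ ≤ Q' φ) {t : T}
    (ht : HasHNFiltration Q t) : HasHNFiltration Q' t := by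
  obtain ⟨n, x, q, φ, h₀, h₁, h₂, h₃⟩ := ht
  exact ⟨n, x, q, φ, h₀, h₁, h₂, fun i ↦ ⟨(h₃ i).1, h _ _ (h₃ i).2.1, (h₃ i).2.2⟩⟩

theorem HasHNFiltration.of_iso {Q : Φ → ObjectProperty T} {t t' : T} (e : t ≅ t')
    (ht : HasHNFiltration Q t) : HasHNFiltration Q t' := by
  obtain ⟨n, x, q, φ, h₀, ⟨e'⟩, h₂, h₃⟩ := ht
  exact ⟨n, x, q, φ, h₀, ⟨e' ≪≫ e⟩, h₂, h₃⟩

theorem HasHNFiltration.of_isZero (Q : Φ → ObjectProperty T) {t : T} (ht : IsZero t) :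
    HasHNFiltration Q t :=
  ⟨0, fun _ ↦ t, Fin.elim0, Fin.elim0, ht, ⟨Iso.refl _⟩, fun i ↦ i.elim0, fun i ↦ i.elim0⟩

/-- A filtration with phases below `φ₀` is prolonged by an object of phase `φ₀`. -/
theorem HasHNFiltration.snoc {Q : Φ → ObjectProperty T} {φ₀ : Φ} {a t q₀ : T}
    (ha : HasHNFiltration (fun φ X ↦ φ < φ₀ ∧ Q φ X) a) (hq : Q φ₀ q₀)
    {f : a ⟶ t} {g : t ⟶ q₀} {h : q₀ ⟶ a⟦(1 : ℤ)⟧} (H : Triangle.mk f g h ∈ distTriang T) :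
    HasHNFiltration Q t := by
  -- Factors of a tower must be non-zero, so a zero `q₀` is not appended; `f` is then invertible.
  by_cases hq₀ : IsZero q₀
  · have : IsIso f := (Triangle.isZero₃_iff_isIso₁ _ H).1 hq₀
    exact (ha.mono fun φ X hX ↦ hX.2).of_iso (asIso f)
  obtain ⟨n, x, q, φ, h₀, ⟨e⟩, h₂, h₃⟩ := ha
  refine ⟨n + 1, Fin.snoc (α := fun _ ↦ T) x t, Fin.snoc (α := fun _ ↦ T) q q₀,
    Fin.snoc (α := fun _ ↦ Φ) φ φ₀, ?_, ⟨eqToIso (by simp)⟩, ?_, fun i ↦ ?_⟩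
  · rw [← Fin.castSucc_zero, Fin.snoc_castSucc]
    exact h₀
  · intro i j hij
    induction j using Fin.lastCases with
    | last =>
      induction i using Fin.lastCases with
      | last => exact absurd hij (lt_irrefl _)
      | cast i => simpa using (h₃ i).2.1.1
    | cast j =>
      induction i using Fin.lastCases with
      | last => exact absurd hij (not_lt.2 (Fin.le_last _))
      | cast i => simpa using h₂ (by simpa using hij)
  -- Objects are replaced by variables with equations, so that `subst` avoids casts between the
  -- types of the morphisms.
  · suffices ∀ {X Y Z : T} {ψ : Φ}, X = Fin.snoc (α := fun _ ↦ T) x t i.castSucc →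
        Y = Fin.snoc (α := fun _ ↦ T) x t i.succ → Z = Fin.snoc (α := fun _ ↦ T) q q₀ i →
        ψ = Fin.snoc (α := fun _ ↦ Φ) φ φ₀ i → ¬ IsZero Z ∧ Q ψ Z ∧
          ∃ (f : X ⟶ Y) (g : Y ⟶ Z) (h : Z ⟶ X⟦(1 : ℤ)⟧), Triangle.mk f g h ∈ distTriang T from
      this rfl rfl rfl rfl
    intro X Y Z ψ hX hY hZ hψ
    induction i using Fin.lastCases with
    | last =>
      rw [Fin.snoc_castSucc] at hX
      rw [Fin.succ_last, Fin.snoc_last] at hY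
      rw [Fin.snoc_last] at hZ hψ
      subst hX hY hZ hψ
      exact ⟨hq₀, hq, e.hom ≫ f, g, h ≫ e.inv⟦(1 : ℤ)⟧', isomorphic_distinguished _ H _
        (Triangle.isoMk _ _ e (Iso.refl _) (Iso.refl _) (Category.comp_id _)
          ((Category.comp_id _).trans (Category.id_comp _).symm) (by
            change (h ≫ e.inv⟦(1 : ℤ)⟧') ≫ e.hom⟦(1 : ℤ)⟧' = 𝟙 Z ≫ h
            rw [Category.assoc, ← Functor.map_comp, e.inv_hom_id,
              CategoryTheory.Functor.map_id, Category.comp_id, Category.id_comp]))⟩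
    | cast i =>
      rw [Fin.snoc_castSucc] at hX hZ hψ
      rw [Fin.succ_castSucc, Fin.snoc_castSucc] at hY
      subst hX hY hZ hψ
      exact ⟨(h₃ i).1, (h₃ i).2.1.2, (h₃ i).2.2⟩

theorem plusClosure.mono {P P' : ObjectProperty T} (h : P ≤ P') :
    plusClosure P ≤ plusClosure P' := by
  intro X hX
  induction hX with
  | of hX => exact .of (h _ hX)
  | zero hX => exact .zero hX
  | ext D hD _ _ h₁ h₃ => exact .ext D hD h₁ h₃
  | summand r _ h => exact .summand r h

theorem plusClosure_le {P P' : ObjectProperty T} [P'.IsStableUnderRetracts]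
    [P'.IsTriangulatedClosed₂] (h₀ : ∀ X, IsZero X → P' X) (h : P ≤ P') : plusClosure P ≤ P' := by
  intro X hX
  induction hX with
  | of hX => exact h _ hX
  | zero hX => exact h₀ _ hX
  | ext D hD _ _ h₁ h₃ => exact P'.ext_of_isTriangulatedClosed₂ D hD h₁ h₃
  | summand r _ h => exact P'.prop_of_retract r h

theorem HasHNFiltration.plusClosure {Q : Φ → ObjectProperty T} {t : T}
    (ht : HasHNFiltration Q t) : plusClosure (fun X ↦ ∃ φ, Q φ X) t := by
  obtain ⟨n, x, q, φ, h₀, ⟨e⟩, -, h₃⟩ := ht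
  refine .summand e.symm.retract ?_
  generalize Fin.last n = i
  induction i using Fin.induction with
  | zero => exact .zero h₀
  | succ i ih =>
    obtain ⟨-, hq, f, g, h, H⟩ := h₃ i
    exact .ext _ H ih (.of ⟨_, hq⟩)

end Filtrations

/-- An object of `Σʲ B ∩ Σʲ⁺ᵏ A` is filtered by objects of `Σⁱ C` with `j < i ≤ j + k`. -/
theorem IsCoTStructure.hasHNFiltration {A B : ObjectProperty T} (hAB : IsCoTStructure A B)
    (j : ℤ) (k : ℕ) {u : T} (hB : susp j B u) (hA : susp (j + k) A u) :
    HasHNFiltration (fun φ X ↦ φ < ((j + k + 1 : ℤ) : WithTop ℤ) ∧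
      ((j + 1 : ℤ) : WithTop ℤ) ≤ φ ∧ coSlice A B φ X) u := by
  induction k generalizing u with
  | zero => exact .of_isZero _ (hAB.isZero_of_left_right (n := j) (by simpa using hA) hB)
  | succ k ih =>
    obtain ⟨a, b, f, g, h, ha, haB, hb, H⟩ : ∃ (a b : T) (f : a ⟶ u) (g : u ⟶ b)
        (h : b ⟶ a⟦(1 : ℤ)⟧), susp (j + k) A a ∧ susp j B a ∧ susp (j + k) B b ∧
          Triangle.mk f g h ∈ distTriang T := by
      -- For `k = 0` truncation at `j` need not leave `a` in Σʲ B, but `u` already lies in Σʲ⁺¹ C,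
      -- so `a = 0` works. For `k > 0` the truncation is at `j + k ≥ j + 1`.
      rcases k.eq_zero_or_pos with rfl | hk
      · exact ⟨_, _, _, _, _, hAB.zero_left _ (isZero_zero T), hAB.zero_right _ (isZero_zero T),
          by simpa using hB, contractible_distinguished₁ u⟩
      · obtain ⟨a, b, f, g, h, ha, hb, H⟩ := (hAB.shift (j + k)).exists_triangle u
        exact ⟨a, b, f, g, h, ha, hAB.right_of_distTriang₁ H (by lia) hB hb, hb, H⟩
    have hbC : coSlice A B ((j + (k + 1 : ℕ) : ℤ) : WithTop ℤ) b := by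
      change susp (j + (k + 1 : ℕ)) (coheart A B) b
      rw [hAB.susp_coheart]
      exact ⟨hAB.left_of_distTriang₃ H (by push_cast; lia) ha hA,
        hAB.susp_right_anti (by push_cast; lia) _ hb⟩
    have hφ : ((j + k + 1 : ℤ) : WithTop ℤ) = (j + (k + 1 : ℕ) : ℤ) := by
      push_cast; rw [add_assoc]
    have hφ' : ((j + (k + 1 : ℕ) : ℤ) : WithTop ℤ) < (j + (k + 1 : ℕ) + 1 : ℤ) :=
      WithTop.coe_lt_coe.2 (by lia)
    refine HasHNFiltration.snoc ((ih haB ha).mono fun φ X hX ↦ ?_)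
      ⟨hφ', WithTop.coe_le_coe.2 (by push_cast; lia), hbC⟩ H
    rw [hφ] at hX
    exact ⟨hX.1, hX.1.trans hφ', hX.2⟩

end CoSlicing

namespace CoSlicing

section

variable {T : Type u} [Category.{v} T] [HasShift T ℤ]

theorem mem_iInf_susp_iff (B : ObjectProperty T) (X : T) :
    (⨅ n : ℤ, susp n B) X ↔ ∀ n : ℤ, susp n B X := by
  simp [iInf_apply]

theorem coSlice_coe [Preadditive T] (A B : ObjectProperty T) (n : ℤ) :
    coSlice A B (n : WithTop ℤ) = susp n (coheart A B) := rfl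

theorem coSlice_top [Preadditive T] (A B : ObjectProperty T) :
    coSlice A B ⊤ = ⨅ i : ℤ, susp i B := rfl

end

variable {T : Type u} [Category.{v} T] [HasZeroObject T] [HasShift T ℤ] [Preadditive T]
  [∀ n : ℤ, (shiftFunctor T n).Additive] [Pretriangulated T]

/-! ### The thick subcategory ⋃ Σⁿ A, its right orthogonal ⋂ Σⁿ B, and the slices -/

namespace IsCoTStructure

variable {A B : ObjectProperty T}

theorem isStableUnderRetracts_iSup_left (hAB : IsCoTStructure A B) :
    (⨆ n : ℤ, susp n A).IsStableUnderRetracts where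
  of_retract r hX := by
    have := hAB.summand_left
    rw [ObjectProperty.prop_iSup_iff] at hX ⊢
    obtain ⟨n, hn⟩ := hX
    exact ⟨n, (susp n A).prop_of_retract r hn⟩

theorem isTriangulated_iSup_left (hAB : IsCoTStructure A B) :
    (⨆ n : ℤ, susp n A).IsTriangulated := by
  have := hAB.isClosedUnderIsomorphisms_left
  have := hAB.isStableUnderRetracts_iSup_left
  have : (⨆ n : ℤ, susp n A).ContainsZero :=
    ⟨_, isZero_zero T, (ObjectProperty.prop_iSup_iff _ _).2 ⟨0, hAB.zero_left 0 (isZero_zero T)⟩⟩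
  have : (⨆ n : ℤ, susp n A).IsStableUnderShift ℤ := ⟨fun a ↦ ⟨fun X hX ↦ by
    rw [ObjectProperty.prop_shift_iff]
    rw [ObjectProperty.prop_iSup_iff] at hX ⊢
    obtain ⟨n, hn⟩ := hX
    exact ⟨n + a, (susp_shift_iff _ _ _ _).2 (by simpa using hn)⟩⟩⟩
  have : (⨆ n : ℤ, susp n A).IsTriangulatedClosed₂ := .mk' fun X hX h₁ h₃ ↦ by
    rw [ObjectProperty.prop_iSup_iff] at h₁ h₃ ⊢
    obtain ⟨m, hm⟩ := h₁
    obtain ⟨n, hn⟩ := h₃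
    exact ⟨max m n, hAB.left_of_distTriang₂ (f := X.mor₁) (g := X.mor₂) (h := X.mor₃) hX
      (hAB.susp_left_mono (le_max_left _ _) _ hm) (hAB.susp_left_mono (le_max_right _ _) _ hn)⟩
  constructor

theorem rightOrthogonal_iSup_left (hAB : IsCoTStructure A B) :
    (⨆ n : ℤ, susp n A).rightOrthogonal = ⨅ n : ℤ, susp n B := by
  ext X
  rw [mem_iInf_susp_iff]
  refine ⟨fun hX n ↦ ?_, fun hX Y f hY ↦ ?_⟩
  · rw [← (hAB.shift n).rightOrthogonal_eq]
    exact fun Y f hY ↦ hX f ((ObjectProperty.prop_iSup_iff _ _).2 ⟨n, hY⟩)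
  · obtain ⟨n, hn⟩ := (ObjectProperty.prop_iSup_iff _ _).1 hY
    exact (hAB.shift n).hom_vanish hn (hX n) f

/-- If s ∈ Σⁱ B, its truncation at i + 1 has left term in Σⁱ⁺¹ C, which maps trivially to s. So s is
a retract of the right term, in Σⁱ⁺¹ B. -/
theorem mem_iInf_right_of_hom_coheart_eq_zero (hAB : IsCoTStructure A B) (hB : IsBoundedAbove B)
    {s : T} (hs : ∀ c : T, coheart A B c → ∀ (n : ℤ) (f : c ⟶ s⟦n⟧), f = 0) :
    (⨅ n : ℤ, susp n B) s := by
  have := hAB.summand_right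
  have step : ∀ i : ℤ, susp i B s → susp (i + 1) B s := fun i hi ↦ by
    obtain ⟨a, b, f, g, h, ha, hb, H⟩ := (hAB.shift (i + 1)).exists_triangle s
    have haC : susp (i + 1) (coheart A B) a := by
      rw [hAB.susp_coheart]
      exact ⟨ha, by simpa using hAB.right_of_distTriang₁ H le_rfl hi hb⟩
    have hf : f = 0 := (shiftFunctor T (-(i + 1))).map_injective (by
      rw [hs _ haC _ ((shiftFunctor T (-(i + 1))).map f), Functor.map_zero])
    obtain ⟨y, hy⟩ := exists_desc_of_distTriang H (𝟙 s) (by rw [hf, zero_comp])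
    exact (susp (i + 1) B).prop_of_retract ⟨g, y, hy.symm⟩ hb
  obtain ⟨i, hi⟩ := hB s
  rw [mem_iInf_susp_iff]
  intro n
  rcases le_total n i with h | h
  · exact hAB.susp_right_anti h _ hi
  · induction n, h using Int.leInduction with
    | base => exact hi
    | succ n _ ih => exact step n ih

/-- If the co-heart together with an object of `⋂ᵢ Σⁱ B` generates, then each object is an
extension of an object of `⋂ᵢ Σⁱ B` by an object of `⋃ᵢ Σⁱ A`. -/
theorem exists_triangle_iSup_iInf [IsTriangulated T] (hT : IsKrullSchmidt T)
    (hAB : IsCoTStructure A B) {s : T} (hs : (⨅ n : ℤ, susp n B) s)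
    (hgen : (addClosure (coheart A B ⊔ ObjectProperty.singleton s)).triangEnvelope = ⊤) (t : T) :
    ∃ (a d : T) (f : a ⟶ t) (g : t ⟶ d) (h : d ⟶ a⟦(1 : ℤ)⟧) (n : ℤ),
      susp n A a ∧ (⨅ n : ℤ, susp n B) d ∧ Triangle.mk f g h ∈ distTriang T := by
  have := hT.isIdempotentComplete
  have := hAB.summand_left
  have := hAB.isTriangulated_iSup_left
  have := hAB.isStableUnderRetracts_iSup_left
  have := isStableUnderRetracts_extensionProduct_rightOrthogonal (⨆ n : ℤ, susp n A)
  have := isTriangulatedClosed₂_extensionProduct_rightOrthogonal (⨆ n : ℤ, susp n A)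
  set P := (⨆ n : ℤ, susp n A).extensionProduct (⨆ n : ℤ, susp n A).rightOrthogonal with hP
  have hAP : (⨆ n : ℤ, susp n A) ≤ P := ObjectProperty.le_extensionProduct_left _
  have hDP : (⨆ n : ℤ, susp n A).rightOrthogonal ≤ P :=
    ObjectProperty.le_extensionProduct_right _
  have : P.ContainsZero := ⟨_, isZero_zero T, hDP _ (ObjectProperty.prop_zero _)⟩
  have : P.IsTriangulated := by constructor
  have hadd : addClosure (coheart A B ⊔ ObjectProperty.singleton s) ≤ P := by
    rintro X ⟨n, f, hf, ⟨r⟩⟩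
    refine P.prop_of_retract r
      (P.prop_of_isLimit_fan (biproduct.isLimit f) fun i ↦ ?_)
    rcases hf i with h | h
    · refine hAP _ ((ObjectProperty.prop_iSup_iff _ _).2 ⟨0, ?_⟩)
      rw [susp_zero]
      exact h.1
    · obtain rfl := (ObjectProperty.singleton_iff _ _).1 h
      refine hDP _ ?_
      rwa [hAB.rightOrthogonal_iSup_left]
  -- `P` is thick and contains the generators, so it contains every object.
  have ht : P t := (ObjectProperty.triangEnvelope_le_iff _).2 hadd _
    (by rw [hgen]; trivial)
  obtain ⟨a, d, f, g, h, H, ha, hd⟩ := ht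
  obtain ⟨n, hn⟩ := (ObjectProperty.prop_iSup_iff _ _).1 ha
  rw [hAB.rightOrthogonal_iSup_left] at hd
  exact ⟨a, d, f, g, h, n, hn, hd, H⟩

theorem coSlice_le_right (hAB : IsCoTStructure A B) {n : ℤ} {φ : WithTop ℤ}
    (h : (n : WithTop ℤ) ≤ φ) : coSlice A B φ ≤ susp (n - 1) B := by
  induction φ with
  | top => exact iInf_le _ _
  | coe m =>
    rw [coSlice_coe, hAB.susp_coheart]
    exact inf_le_right.trans (hAB.susp_right_anti (by simpa using WithTop.coe_le_coe.1 h))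

theorem coSlice_le_left (hAB : IsCoTStructure A B) {n : ℤ} {φ : WithTop ℤ}
    (h : φ < (n : WithTop ℤ)) : coSlice A B φ ≤ susp (n - 1) A := by
  induction φ with
  | top => exact absurd h (not_lt.2 le_top)
  | coe m =>
    rw [coSlice_coe, hAB.susp_coheart]
    exact inf_le_left.trans (hAB.susp_left_mono (by
      have := WithTop.coe_lt_coe.1 h
      lia))

theorem isStableUnderRetracts_coSlice (hAB : IsCoTStructure A B) (φ : WithTop ℤ) :
    (coSlice A B φ).IsStableUnderRetracts := by
  have := hAB.summand_left
  have := hAB.summand_right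
  refine ⟨fun {X Y} r hY ↦ ?_⟩
  induction φ with
  | top =>
    rw [coSlice_top, mem_iInf_susp_iff] at hY ⊢
    exact fun i ↦ (susp i B).prop_of_retract r (hY i)
  | coe n =>
    rw [coSlice_coe, hAB.susp_coheart] at hY ⊢
    exact ⟨(susp _ A).prop_of_retract r hY.1, (susp _ B).prop_of_retract r hY.2⟩

theorem isTriangulatedClosed₂_coSlice (hAB : IsCoTStructure A B) (φ : WithTop ℤ) :
    (coSlice A B φ).IsTriangulatedClosed₂ := by
  have := hAB.isStableUnderRetracts_coSlice φ
  refine .mk' fun X hX h₁ h₃ ↦ ?_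
  induction φ with
  | top =>
    rw [coSlice_top, mem_iInf_susp_iff] at h₁ h₃ ⊢
    exact fun i ↦ hAB.right_of_distTriang₂ (f := X.mor₁) (g := X.mor₂) (h := X.mor₃) hX
      (h₁ i) (h₃ i)
  | coe n =>
    rw [coSlice_coe, hAB.susp_coheart] at h₁ h₃ ⊢
    exact ⟨hAB.left_of_distTriang₂ (f := X.mor₁) (g := X.mor₂) (h := X.mor₃) hX h₁.1 h₃.1,
      hAB.right_of_distTriang₂ (f := X.mor₁) (g := X.mor₂) (h := X.mor₃) hX h₁.2 h₃.2⟩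

theorem containsZero_coSlice (hAB : IsCoTStructure A B) (φ : WithTop ℤ) :
    (coSlice A B φ).ContainsZero := by
  refine ⟨_, isZero_zero T, ?_⟩
  induction φ with
  | top =>
    rw [coSlice_top, mem_iInf_susp_iff]
    exact fun i ↦ hAB.zero_right i (isZero_zero T)
  | coe n =>
    rw [coSlice_coe, hAB.susp_coheart]
    exact ⟨hAB.zero_left _ (isZero_zero T), hAB.zero_right _ (isZero_zero T)⟩

theorem susp_coSlice (hAB : IsCoTStructure A B) (φ : WithTop ℤ) :
    susp 1 (coSlice A B φ) = coSlice A B (lamInfty φ) := by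
  induction φ with
  | top =>
    have := hAB.isClosedUnderIsomorphisms_right
    rw [lamInfty_top, coSlice_top]
    ext X
    rw [mem_iInf_susp_iff]
    change (⨅ i : ℤ, susp i B) (X⟦(-1 : ℤ)⟧) ↔ _
    rw [mem_iInf_susp_iff]
    simp only [susp_shift_iff]
    exact ⟨fun h i ↦ by simpa using h (i - 1), fun h i ↦ h _⟩
  | coe n =>
    have : (coheart A B).IsStableUnderRetracts := by
      have := hAB.summand_left
      have := hAB.summand_right
      exact ⟨fun r h ↦ ⟨A.prop_of_retract r h.1, (susp (-1) B).prop_of_retract r h.2⟩⟩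
    rw [lamInfty_coe, coSlice_coe, coSlice_coe, susp_susp, add_comm]

theorem homVanish_coSlice (hAB : IsCoTStructure A B) {φ₁ φ₂ : WithTop ℤ} (h : φ₁ < φ₂) :
    HomVanish (coSlice A B φ₁) (coSlice A B φ₂) := by
  intro X Y hX hY f
  lift φ₁ to ℤ using h.ne_top
  have hX' := hAB.coSlice_le_left (n := φ₁ + 1) (WithTop.coe_lt_coe.2 (lt_add_one φ₁)) _ hX
  have h' : ((φ₁ + 1 : ℤ) : WithTop ℤ) ≤ φ₂ := by
    induction φ₂ with
    | top => exact le_top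
    | coe m => exact WithTop.coe_le_coe.2 (WithTop.coe_lt_coe.1 h)
  have hY' := hAB.coSlice_le_right h' _ hY
  exact (hAB.shift _).hom_vanish hX' hY' f

/-- Desuspending `d` loses nothing, so `a` inherits the bound of `t` and becomes bounded on both
sides as soon as it lies in some Σⁿ A. -/
theorem susp_right_of_distTriang_iInf (hAB : IsCoTStructure A B) {a t d : T} {f : a ⟶ t}
    {g : t ⟶ d} {h : d ⟶ a⟦(1 : ℤ)⟧} (H : Triangle.mk f g h ∈ distTriang T) {i : ℤ}
    (ht : susp i B t) (hd : (⨅ n : ℤ, susp n B) d) : susp i B a :=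
  hAB.right_of_distTriang₁ H le_rfl ht ((mem_iInf_susp_iff _ _).1 hd (i + 1))

theorem isCoSlicingWith (hAB : IsCoTStructure A B) (hB : IsBoundedAbove B)
    (htri : ∀ t : T, ∃ (a d : T) (f : a ⟶ t) (g : t ⟶ d) (h : d ⟶ a⟦(1 : ℤ)⟧) (n : ℤ),
      susp n A a ∧ (⨅ n : ℤ, susp n B) d ∧ Triangle.mk f g h ∈ distTriang T) :
    IsCoSlicingWith lamInfty (coSlice A B) where
  zero_mem := hAB.containsZero_coSlice
  summand := hAB.isStableUnderRetracts_coSlice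
  extension := hAB.isTriangulatedClosed₂_coSlice
  le_lam φ := by
    induction φ with
    | top => exact le_rfl
    | coe n =>
      rw [lamInfty_coe]
      exact WithTop.coe_le_coe.2 (by lia)
  susp_eq := hAB.susp_coSlice
  hom_vanish _ _ h := hAB.homVanish_coSlice h
  hn t _ := by
    obtain ⟨a, d, f, g, h, n, ha, hd, H⟩ := htri t
    obtain ⟨i, hi⟩ := hB t
    -- The maximum makes the length `k` of the range of phases a natural number, even when `n < i`.
    obtain ⟨k, hk⟩ := Int.le.dest (le_max_left i n)
    refine HasHNFiltration.snoc (φ₀ := ⊤) (q₀ := d) (((hAB.hasHNFiltration i k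
      (hAB.susp_right_of_distTriang_iInf H hi hd)
      (hAB.susp_left_mono (hk ▸ le_max_right i n) _ ha))).mono fun φ X hX ↦ ?_)
      (by rwa [coSlice_top]) H
    exact ⟨hX.1.trans (WithTop.coe_lt_top _), hX.2.2⟩

theorem inducedLeft_coSlice (hAB : IsCoTStructure A B) (hB : IsBoundedAbove B) (n : ℤ) :
    inducedLeft (coSlice A B) (n : WithTop ℤ) = susp (n - 1) A := by
  have := hAB.summand_left
  have := hAB.extension_left (n - 1)
  refine le_antisymm (plusClosure_le (fun X ↦ hAB.zero_left _) ?_) fun X hX ↦ ?_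
  · rintro X ⟨φ, hφ, hX⟩
    exact hAB.coSlice_le_left hφ _ hX
  · obtain ⟨i, hi⟩ := hB X
    -- Starting at or below `n - 1` makes the phases of the tower end exactly below `n`.
    obtain ⟨k, hk⟩ := Int.le.dest (min_le_right i (n - 1))
    have hX' := (hAB.hasHNFiltration (min i (n - 1)) k (hAB.susp_right_anti (min_le_left _ _) _ hi)
      (by rwa [hk])).plusClosure
    rw [hk, sub_add_cancel] at hX'
    exact hX'.mono (fun Y ⟨φ, h₁, _, h₃⟩ ↦ ⟨φ, h₁, h₃⟩) _

theorem inducedRight_coSlice (hAB : IsCoTStructure A B)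
    (htri : ∀ t : T, ∃ (a d : T) (f : a ⟶ t) (g : t ⟶ d) (h : d ⟶ a⟦(1 : ℤ)⟧) (n : ℤ),
      susp n A a ∧ (⨅ n : ℤ, susp n B) d ∧ Triangle.mk f g h ∈ distTriang T) (n : ℤ) :
    inducedRight (coSlice A B) (n : WithTop ℤ) = susp (n - 1) B := by
  have := hAB.summand_right
  have := hAB.extension_right (n - 1)
  refine le_antisymm (plusClosure_le (fun X ↦ hAB.zero_right _) ?_) fun X hX ↦ ?_
  · rintro X ⟨φ, hφ, hX⟩
    exact hAB.coSlice_le_right hφ _ hX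
  · obtain ⟨a, d, f, g, h, m, ha, hd, H⟩ := htri X
    obtain ⟨k, hk⟩ := Int.le.dest (le_max_left (n - 1) m)
    have ha' := (hAB.hasHNFiltration (n - 1) k (hAB.susp_right_of_distTriang_iInf H hX hd)
      (hAB.susp_left_mono (hk ▸ le_max_right _ _) _ ha)).plusClosure
    rw [sub_add_cancel] at ha'
    -- `a` is built from phases at least `n`, and `d` has phase ∞.
    exact .ext _ H (plusClosure.mono (fun Y ⟨φ, _, h₂, h₃⟩ ↦ ⟨φ, h₂, h₃⟩) _ ha')
      (.of ⟨⊤, le_top, hd⟩)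

end IsCoTStructure

theorem IsComplement.hom_eq_zero {S : ObjectProperty T} {s : T} (hs : IsComplement S s) {c : T}
    (hc : S c) {n : ℤ} (hn : 0 < n) (f : c ⟶ s⟦n⟧) : f = 0 := by
  have key : ∀ X, (S ⊔ ObjectProperty.singleton s) X →
      addClosure (S ⊔ ObjectProperty.singleton s) X := fun X hX ↦
    ⟨1, fun _ ↦ X, fun _ ↦ hX, ⟨⟨biproduct.ι (fun _ : Fin 1 ↦ X) 0, biproduct.π _ 0, by simp⟩⟩⟩
  exact hs.2.1 (key _ (Or.inl hc)) (key _ (Or.inr (by simp))) n hn f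

end CoSlicing

theorem mainTheorem12 {T : Type u} [Category.{v} T] [HasZeroObject T] [HasShift T ℤ]
    [Preadditive T] [∀ n : ℤ, (shiftFunctor T n).Additive] [Pretriangulated T] [IsTriangulated T]
    (hT : CoSlicing.IsKrullSchmidt T)
    (A B : ObjectProperty T) (hAB : CoSlicing.IsCoTStructure A B)
    (hC : CoSlicing.IsAlmostSilting (CoSlicing.coheart A B))
    (s : T) (hs : CoSlicing.IsComplement (CoSlicing.coheart A B) s)
    (hom_zero : ∀ c : T, CoSlicing.coheart A B c → ∀ n : ℤ, n ≤ 0 → ∀ f : c ⟶ s⟦n⟧, f = 0)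
    (hB : CoSlicing.IsBoundedAbove B) :
    CoSlicing.IsCoSlicing (CoSlicing.coSlice A B) ∧
    CoSlicing.IsCoSlicingWith CoSlicing.lamInfty (CoSlicing.coSlice A B) ∧
    ∀ n : ℤ,
      CoSlicing.IsCoTStructure
        (CoSlicing.inducedLeft (CoSlicing.coSlice A B) (n : WithTop ℤ))
        (CoSlicing.inducedRight (CoSlicing.coSlice A B) (n : WithTop ℤ)) ∧
      CoSlicing.inducedLeft (CoSlicing.coSlice A B) (n : WithTop ℤ) = CoSlicing.susp (n - 1) A ∧
      CoSlicing.inducedRight (CoSlicing.coSlice A B) (n : WithTop ℤ) =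
        CoSlicing.susp (n - 1) B := by
  -- Degrees `n ≤ 0` are the hypothesis; degrees `n > 0` come from the silting property.
  have hsD := hAB.mem_iInf_right_of_hom_coheart_eq_zero hB (s := s) fun c hc n f ↦
    (le_or_gt n 0).elim (fun hn ↦ hom_zero c hc n hn f) fun hn ↦ hs.hom_eq_zero hc hn f
  have htri := hAB.exists_triangle_iSup_iInf hT hsD hs.2.2
  have hco := hAB.isCoSlicingWith hB htri
  refine ⟨⟨_, hco⟩, hco, fun n ↦ ?_⟩
  have hl := hAB.inducedLeft_coSlice hB n
  have hr := hAB.inducedRight_coSlice htri n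
  exact ⟨hl ▸ hr ▸ hAB.shift (n - 1), hl, hr⟩
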